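/- Theorem. Let $(\Omega,\mathcal A,\mathbb P,\mathbb F)$, $\mathbb F=(\mathcal F_n)_{n\ge 0}$, be a filtered probability space and let $X=(X_n)_{n\ge 0}$ be a real $\mathbb F$-martingale with $X_0=0$ a.s. Let $p\ge 2$ be real, and put $$\Delta X_j:=X_j-X_{j-1},\qquad \beta_{n,p}:=\frac1n\sum_{j=1}^n\mathbb E\big[|\Delta X_j|^p\big]\in[0,\infty]\quad(n\ge 1),\qquad C_p:=\big[8(p-1)\max\{1,2^{p-1}\}\big]^p .$$ For a positive sequence $a=(a_n)_{n\ge 1}$ and $N\in\{0,1,2,\dots\}\cup\{\infty\}$ let $\mathcal S_{a,1}(N):=\sum_{n=0}^{N-1}a_{1+n}$, with $\mathcal S_{a,1}(0)=0$, and for a positive sequence $\epsilon=(\varepsilon_n)_{n\ge 1}$ let $\mathcal O_\epsilon:=\sum_{n=1}^\infty \mathbf 1\{|X_n/n|>\varepsilon_n\}$, with $\mathcal O_\varepsilon$ denoting the case of a constant sequence $\varepsilon_n=\varepsilon$. Assume that $$K_p:=\sum_{n=1}^\infty \frac{\beta_{n,p}}{n^{p/2-1}}<\infty .$$ Then $\lim_{n\to\infty}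 X_n/n=0$ $\mathbb P$-a.s. Moreover: (a) For every $\varepsilon>0$ and every positive, nondecreasing sequence $a=(a_n)_{n\ge1}$ such that $$K_{a,p}:=\sum_{n=1}^\infty a_n\sum_{m=n}^\infty\frac{\beta_{m,p}}{m^{p/2-1}}<\infty$$ we have $$\mathbb E\big[\mathcal S_{a,1}(\mathcal O_\varepsilon)\big]\le C_p\,\varepsilon^{-p}K_{a,p},$$ with strict inequality whenever $K_{a,p}>0$, and $$\mathbb P(\mathcal O_\varepsilon\ge k)\le \mathcal S_{a,1}(k)^{-1}\,C_p\,\varepsilon^{-p}K_{a,p}\qquad\text{for all integers }k\ge 1 .$$ (b) For every positive, nonincreasing sequence $\epsilon=(\varepsilon_n)_{n\ge1}$ and every positive, nondecreasing sequence $a=(a_n)_{n\ge1}$ such that $$K_{a,\epsilon,p}:=\sum_{n=1}^\infty a_n\sum_{m=n}^\infty\frac{\beta_{m,p}}{\varepsilon_m^p\,m^{p/2-1}}<\infty$$ we have $$\limsup_{n\to\infty}\Big|\frac{X_n}{n}\Big|\,\varepsilon_n^{-1}\le 1\quad\mathbb P\text{-a.s.}\qquad\text{and}\qquad \mathbb E\big[\mathcal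 S_{a,1}(\mathcal O_\epsilon)\big]\le C_p\,K_{a,\epsilon,p}.$$ -/

import Mathlib

open MeasureTheory ProbabilityTheory Filter Topology
open scoped ENNReal

namespace MDF

noncomputable section

/-- `S_{a,n₀}(N) = ∑_{n=0}^{N-1} a_{n₀+n}`, the sum of the first `N` terms of the nonnegative
sequence `a` starting at index `n₀`; here `N` may be infinite. -/
def partialSum (a : ℕ → ℝ) (n₀ : ℕ) (N : ℕ∞) : ℝ≥0∞ :=
  ∑' n : ℕ, if (n : ℕ∞) < N then ENNReal.ofReal (a (n₀ + n)) else 0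

/-- The overlap statistic `O_ε = ∑_{n ≥ 1} 1{|X_n / n| > ε_n}`, that is, the number (possibly
infinite) of indices `n ≥ 1` with `|X_n / n| > ε_n`. -/
def overlap {Ω : Type*} (X : ℕ → Ω → ℝ) (ε : ℕ → ℝ) (ω : Ω) : ℕ∞ :=
  {n : ℕ | 1 ≤ n ∧ ε n < |X n ω / n|}.encard

/-- `β_{n,p} = (1/n) ∑_{j=1}^n E|X_j - X_{j-1}|^p`, as an extended nonnegative number. -/
def beta {Ω : Type*} [MeasurableSpace Ω] (P : Measure Ω) (X : ℕ → Ω → ℝ) (p : ℝ) (n : ℕ) :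
    ℝ≥0∞ :=
  (∑ j ∈ Finset.range n, ∫⁻ ω, ENNReal.ofReal (|X (j + 1) ω - X j ω| ^ p) ∂P) / n

/-- `C_p = [8 (p - 1) max{1, 2^{p-1}}]^p`. -/
def const (p : ℝ) : ℝ := (8 * (p - 1) * max 1 (2 ^ (p - 1))) ^ p

/-- `K_p = ∑_{n ≥ 1} β_{n,p} / n^{p/2-1}`. -/
def sumBeta {Ω : Type*} [MeasurableSpace Ω] (P : Measure Ω) (X : ℕ → Ω → ℝ) (p : ℝ) : ℝ≥0∞ :=
  ∑' n : Set.Ici 1, beta P X p n / ((n : ℕ) : ℝ≥0∞) ^ (p / 2 - 1)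

/-- `K_{a,p} = ∑_{n ≥ 1} a_n ∑_{m ≥ n} β_{m,p} / m^{p/2-1}`. -/
def weightedSum {Ω : Type*} [MeasurableSpace Ω] (P : Measure Ω) (X : ℕ → Ω → ℝ) (a : ℕ → ℝ)
    (p : ℝ) : ℝ≥0∞ :=
  ∑' n : Set.Ici 1, ENNReal.ofReal (a n) *
    ∑' m : Set.Ici (n : ℕ), beta P X p m / ((m : ℕ) : ℝ≥0∞) ^ (p / 2 - 1)

/-- `K_{a,ε,p} = ∑_{n ≥ 1} a_n ∑_{m ≥ n} β_{m,p} / (ε_m^p m^{p/2-1})`. -/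
def weightedSumTol {Ω : Type*} [MeasurableSpace Ω] (P : Measure Ω) (X : ℕ → Ω → ℝ) (a ε : ℕ → ℝ)
    (p : ℝ) : ℝ≥0∞ :=
  ∑' n : Set.Ici 1, ENNReal.ofReal (a n) *
    ∑' m : Set.Ici (n : ℕ),
      beta P X p m / (ENNReal.ofReal (ε m) ^ p * ((m : ℕ) : ℝ≥0∞) ^ (p / 2 - 1))

end

end MDF

/-! Everything rests on the moment bound `integral_abs_rpow_le`: `E|X_n|^p` is at most a constant
times `n^(p/2) β_{n,p}`. Expand `|X_k + ΔX|^p` to second order: the linear term integrates to zero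
by the martingale property, and the remainder splits into a large multiple of `|ΔX|^p` and a small
multiple of `|X_k|^p`. With the small multiple tuned to `1/n`, iterating `n` times costs only the
factor `(1 + 1/n)^n ≤ 3`.

Markov's inequality (`measure_exceed_le`) then gives `P(|X_n/n| > e) ≤ C β_{n,p} / (e^p n^(p/2-1))`,
a summable bound. Borel–Cantelli yields the almost sure statements. For the overlap, more than `k`
exceedances force one at some index `m ≥ k + 1`, so a union bound on the tail `m ≥ k + 1`, weighted
by `a_{1+k}` and summed over `k`, gives the double series in (a) and (b). Strictness in (a) comes
from `momentConst p < const p`. -/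

namespace MDF

/-! ### Pointwise inequalities for powers -/

/-- The tangent line of `t ↦ t ^ r` at `s` lies below the graph. -/
lemma rpow_add_tangent_le_rpow {r s t : ℝ} (hr : 1 ≤ r) (hs : 0 ≤ s) (ht : 0 ≤ t) :
    s ^ r + r * s ^ (r - 1) * (t - s) ≤ t ^ r := by
  rcases hs.eq_or_lt with rfl | hs
  · rcases hr.eq_or_lt with rfl | hr
    · simp
    · rw [Real.zero_rpow (by linarith), Real.zero_rpow (by linarith)]
      simpa using Real.rpow_nonneg ht r
  -- Bernoulli's inequality for the ratio `t / s`, scaled by `s ^ r`.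
  · have h := one_add_mul_self_le_rpow_one_add (s := t / s - 1)
      (by have := div_nonneg ht hs.le; linarith) hr
    rw [add_sub_cancel, Real.div_rpow ht hs.le, le_div_iff₀ (Real.rpow_pos_of_pos hs r)] at h
    have e : s ^ r = s ^ (r - 1) * s := by
      rw [← Real.rpow_add_one hs.ne', sub_add_cancel]
    refine le_trans (le_of_eq ?_) h
    rw [e]
    field_simp

lemma rpow_sub_two_mul_sq {p t : ℝ} (hp : 2 ≤ p) (ht : 0 ≤ t) : t ^ (p - 2) * t ^ 2 = t ^ p := by
  rw [← Real.rpow_natCast t 2, ← Real.rpow_add' ht (by norm_num; linarith)]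
  norm_num

lemma rpow_sub_two_mul_self {p t : ℝ} (hp : 2 ≤ p) (ht : 0 ≤ t) :
    t ^ (p - 2) * t = t ^ (p - 1) := by
  rw [← Real.rpow_add_one' ht (by linarith)]
  congr 1; ring

/-- The tangent line of `t ↦ |t| ^ p` at `u` lies below the graph. -/
lemma abs_rpow_add_tangent_le {p : ℝ} (hp : 2 ≤ p) (u x : ℝ) :
    |u| ^ p + p * (|u| ^ (p - 2) * u) * (x - u) ≤ |x| ^ p := by
  refine le_trans ?_ (rpow_add_tangent_le_rpow (by linarith : 1 ≤ p) (abs_nonneg u) (abs_nonneg x))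
  rw [← rpow_sub_two_mul_self hp (abs_nonneg u)]
  have h : u * (x - u) ≤ |u| * (|x| - |u|) := by
    have h₁ : u * x ≤ |u| * |x| := by rw [← abs_mul]; exact le_abs_self _
    have h₂ := abs_mul_abs_self u
    nlinarith
  have h' := mul_le_mul_of_nonneg_left h
    (mul_nonneg (by linarith : 0 ≤ p) (Real.rpow_nonneg (abs_nonneg u) (p - 2)))
  linarith

lemma rpow_mul_self_sub_le_of_nonneg {p u v M : ℝ} (hp : 2 ≤ p) (hv : 0 ≤ v) (huv : v ≤ u)
    (hu : u ≤ M) :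
    u ^ (p - 2) * u - v ^ (p - 2) * v ≤ (p - 1) * M ^ (p - 2) * (u - v) := by
  have hu₀ : 0 ≤ u := hv.trans huv
  rw [rpow_sub_two_mul_self hp hu₀, rpow_sub_two_mul_self hp hv]
  have h := rpow_add_tangent_le_rpow (r := p - 1) (by linarith) hu₀ hv
  have e : p - 1 - 1 = p - 2 := by ring
  rw [e] at h
  have h₁ : u ^ (p - 2) ≤ M ^ (p - 2) := Real.rpow_le_rpow hu₀ hu (by linarith)
  have h₂ := mul_le_mul_of_nonneg_left h₁
    (mul_nonneg (by linarith : 0 ≤ p - 1) (sub_nonneg.2 huv))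
  nlinarith

/-- The derivative of `|t|^(p-2) t` is `(p-1)|t|^(p-2)`, which is at most `(p-1) M^(p-2)` on `[-M,
M]`. For `v ≤ 0 ≤ u` each endpoint is bounded separately and `p - 1 ≥ 1` leaves room. -/
lemma abs_rpow_mul_self_sub_le {p u v M : ℝ} (hp : 2 ≤ p) (huv : v ≤ u) (hu : |u| ≤ M)
    (hv : |v| ≤ M) :
    |u| ^ (p - 2) * u - |v| ^ (p - 2) * v ≤ (p - 1) * M ^ (p - 2) * (u - v) := by
  rcases le_total 0 v with hv₀ | hv₀
  · rw [abs_of_nonneg hv₀, abs_of_nonneg (hv₀.trans huv)]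
    rw [abs_of_nonneg (hv₀.trans huv)] at hu
    exact rpow_mul_self_sub_le_of_nonneg hp hv₀ huv hu
  rcases le_total 0 u with hu₀ | hu₀
  · have h₁ : |u| ^ (p - 2) ≤ M ^ (p - 2) := Real.rpow_le_rpow (abs_nonneg _) hu (by linarith)
    have h₂ : |v| ^ (p - 2) ≤ M ^ (p - 2) := Real.rpow_le_rpow (abs_nonneg _) hv (by linarith)
    have h₀ : 0 ≤ M ^ (p - 2) := (Real.rpow_nonneg (abs_nonneg u) _).trans h₁
    have h₃ := mul_le_mul_of_nonneg_right h₁ hu₀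
    have h₄ := mul_le_mul_of_nonneg_right h₂ (neg_nonneg.2 hv₀)
    have h₅ : 0 ≤ (p - 2) * (M ^ (p - 2) * (u - v)) :=
      mul_nonneg (by linarith) (mul_nonneg h₀ (by linarith))
    nlinarith
  · rw [abs_of_nonpos hv₀] at hv ⊢
    rw [abs_of_nonpos hu₀]
    have := rpow_mul_self_sub_le_of_nonneg hp (neg_nonneg.2 hu₀) (neg_le_neg huv) hv
    linarith

/-- Second order Taylor estimate for `t ↦ |t| ^ p`. -/
lemma abs_add_rpow_le_taylor {p : ℝ} (hp : 2 ≤ p) (x y : ℝ) :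
    |x + y| ^ p ≤ |x| ^ p + p * (|x| ^ (p - 2) * x * y)
      + p * (p - 1) * ((|x| + |y|) ^ (p - 2) * y ^ 2) := by
  -- The tangent is taken at `x + y` and evaluated at `x`, bounding `|x + y|^p` from above with the
  -- slope at `x + y`; `h₂` then replaces this slope by the one at `x`.
  have h₁ := abs_rpow_add_tangent_le hp (x + y) x
  have hx : |x| ≤ |x| + |y| := by linarith [abs_nonneg y]
  have h₂ : (|x + y| ^ (p - 2) * (x + y) - |x| ^ (p - 2) * x) * y
      ≤ (p - 1) * (|x| + |y|) ^ (p - 2) * y * y := by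
    rcases le_total 0 y with hy | hy
    · have := abs_rpow_mul_self_sub_le hp (by linarith : x ≤ x + y) (abs_add_le x y) hx
      rw [add_sub_cancel_left] at this
      exact mul_le_mul_of_nonneg_right this hy
    · have := abs_rpow_mul_self_sub_le hp (by linarith : x + y ≤ x) hx (abs_add_le x y)
      have := mul_le_mul_of_nonneg_right this (neg_nonneg.2 hy)
      linarith
  have h₃ := mul_le_mul_of_nonneg_left h₂ (by linarith : 0 ≤ p)
  nlinarith

/-- Split at `|x| = θ|y|`: below it `|y|` controls everything, above it `y²` is at most `x² / θ²`. A
large `θ` makes the `|x|^p` coefficient small. -/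
lemma abs_add_abs_rpow_mul_sq_le {p θ : ℝ} (hp : 2 ≤ p) (hθ : 1 ≤ θ) (x y : ℝ) :
    (|x| + |y|) ^ (p - 2) * y ^ 2
      ≤ 2 ^ (p - 2) * (θ ^ (p - 2) * |y| ^ p + (θ ^ 2)⁻¹ * |x| ^ p) := by
  have hq : 0 ≤ p - 2 := by linarith
  have hθ₀ : 0 < θ := by linarith
  have hx := abs_nonneg x
  have hy := abs_nonneg y
  have hA : 0 ≤ θ ^ (p - 2) * |y| ^ p := by positivity
  have hB : 0 ≤ (θ ^ 2)⁻¹ * |x| ^ p := by positivity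
  rw [← sq_abs y]
  rcases le_total |x| (θ * |y|) with h | h
  · have h₁ : (|x| + |y|) ^ (p - 2) ≤ (2 * (θ * |y|)) ^ (p - 2) :=
      Real.rpow_le_rpow (by positivity) (by nlinarith) hq
    calc (|x| + |y|) ^ (p - 2) * |y| ^ 2 ≤ (2 * (θ * |y|)) ^ (p - 2) * |y| ^ 2 := by gcongr
      _ = 2 ^ (p - 2) * (θ ^ (p - 2) * |y| ^ p) := by
        rw [Real.mul_rpow (by norm_num) (by positivity), Real.mul_rpow hθ₀.le hy,
          ← rpow_sub_two_mul_sq hp hy]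
        ring
      _ ≤ _ := by gcongr; linarith
  · have h₁ : (|x| + |y|) ^ (p - 2) ≤ (2 * |x|) ^ (p - 2) :=
      Real.rpow_le_rpow (by positivity) (by nlinarith) hq
    have h₂ : |y| ≤ θ⁻¹ * |x| := by rw [inv_mul_eq_div, le_div_iff₀ hθ₀]; linarith
    calc (|x| + |y|) ^ (p - 2) * |y| ^ 2 ≤ (2 * |x|) ^ (p - 2) * (θ⁻¹ * |x|) ^ 2 := by gcongr
      _ = 2 ^ (p - 2) * ((θ ^ 2)⁻¹ * |x| ^ p) := by
        rw [Real.mul_rpow (by norm_num) hx, ← rpow_sub_two_mul_sq hp hx]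
        ring
      _ ≤ _ := by gcongr; linarith

/-! ### The moment bound for martingales -/

section Moment

variable {Ω : Type*} {m0 : MeasurableSpace Ω} {P : Measure Ω}

lemma memLp_of_lintegral_abs_rpow_lt_top {f : Ω → ℝ} {p : ℝ} (hp : 0 < p)
    (hf : AEStronglyMeasurable f P) (h : ∫⁻ ω, ENNReal.ofReal (|f ω| ^ p) ∂P < ∞) :
    MemLp f (ENNReal.ofReal p) P := by
  refine ⟨hf, ?_⟩
  rw [eLpNorm_lt_top_iff_lintegral_rpow_enorm_lt_top (by simpa using hp) ENNReal.ofReal_ne_top,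
    ENNReal.toReal_ofReal hp.le]
  convert h using 3 with ω
  rw [Real.enorm_eq_ofReal_abs, ENNReal.ofReal_rpow_of_nonneg (abs_nonneg _) hp.le]

lemma integrable_abs_rpow_of_memLp {f : Ω → ℝ} {p : ℝ} (hp : 0 < p)
    (hf : MemLp f (ENNReal.ofReal p) P) : Integrable (fun ω => |f ω| ^ p) P := by
  have := hf.integrable_norm_rpow (by simpa using hp) ENNReal.ofReal_ne_top
  simpa [ENNReal.toReal_ofReal hp.le] using this

lemma integrable_abs_rpow_mul_self_mul {p : ℝ} {f g : Ω → ℝ} (hp : 2 ≤ p)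
    (hf : AEStronglyMeasurable f P) (hg : AEStronglyMeasurable g P)
    (hfp : Integrable (fun ω => |f ω| ^ p) P) (hgp : Integrable (fun ω => |g ω| ^ p) P) :
    Integrable (fun ω => |f ω| ^ (p - 2) * f ω * g ω) P := by
  refine (hfp.add hgp).mono' ?_ (ae_of_all _ fun ω => ?_)
  · exact (((hf.aemeasurable.abs.pow_const _).mul hf.aemeasurable).mul
      hg.aemeasurable).aestronglyMeasurable
  · have hf₀ := abs_nonneg (f ω)
    have hg₀ := abs_nonneg (g ω)
    rw [Real.norm_eq_abs, abs_mul, abs_mul, abs_of_nonneg (Real.rpow_nonneg hf₀ (p - 2)),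
      rpow_sub_two_mul_self hp hf₀, Pi.add_apply]
    set s := max |f ω| |g ω| with hs
    have hs₀ : 0 ≤ s := hf₀.trans (le_max_left _ _)
    calc |f ω| ^ (p - 1) * |g ω| ≤ s ^ (p - 1) * s := by
          gcongr
          · linarith
          · exact le_max_left _ _
          · exact le_max_right _ _
      _ = s ^ p := by
          rw [← Real.rpow_add_one' hs₀ (by linarith), sub_add_cancel]
      _ ≤ |f ω| ^ p + |g ω| ^ p := by
          have h₁ := Real.rpow_nonneg hf₀ p
          have h₂ := Real.rpow_nonneg hg₀ p
          rcases max_choice |f ω| |g ω| with h | h <;> rw [hs, h] <;> linarith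

lemma memLp_of_memLp_increments {X : ℕ → Ω → ℝ} (hX0 : ∀ᵐ ω ∂P, X 0 ω = 0) {q : ℝ≥0∞} (n : ℕ)
    (hd : ∀ j < n, MemLp (fun ω => X (j + 1) ω - X j ω) q P) : MemLp (X n) q P := by
  induction n with
  | zero =>
    refine (MemLp.zero (p := q) (μ := P) (ε := ℝ)).ae_eq ?_
    filter_upwards [hX0] with ω h using by simp [h]
  | succ k ih =>
    have h := (ih fun j hj => hd j (hj.trans k.lt_succ_self)).add (hd k k.lt_succ_self)
    convert h using 1
    ext ω
    simp

variable [IsProbabilityMeasure P] {ℱ : Filtration ℕ m0} {X : ℕ → Ω → ℝ} {p : ℝ}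

/-- A function of the present is orthogonal to the next martingale increment. -/
lemma integral_mul_increment_eq_zero (hX : Martingale X ℱ P) (k : ℕ) {f : Ω → ℝ}
    (hf : StronglyMeasurable[ℱ k] f)
    (hint : Integrable (fun ω => f ω * (X (k + 1) ω - X k ω)) P) :
    ∫ ω, f ω * (X (k + 1) ω - X k ω) ∂P = 0 := by
  have hd : Integrable (X (k + 1) - X k) P := (hX.integrable _).sub (hX.integrable _)
  have h₁ : P[f * (X (k + 1) - X k) | ℱ k] =ᵐ[P] f * P[X (k + 1) - X k | ℱ k] :=
    condExp_mul_of_stronglyMeasurable_left hf hint hd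
  have h₂ : P[X (k + 1) - X k | ℱ k] =ᵐ[P] 0 := by
    have h₃ := condExp_sub (hX.integrable (k + 1)) (hX.integrable k) (ℱ k)
    filter_upwards [h₃, hX.condExp_ae_eq (Nat.le_succ k), hX.condExp_ae_eq (le_refl k)]
      with ω a b c
    rw [a, Pi.sub_apply, b, c, sub_self, Pi.zero_apply]
  calc ∫ ω, f ω * (X (k + 1) ω - X k ω) ∂P
      = ∫ ω, (P[f * (X (k + 1) - X k) | ℱ k]) ω ∂P := (integral_condExp (ℱ.le k)).symm
    _ = ∫ ω, (0 : ℝ) ∂P := by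
        refine integral_congr_ae ?_
        filter_upwards [h₁, h₂] with ω a b
        rw [a, Pi.mul_apply, b, Pi.zero_apply, mul_zero]
    _ = 0 := by simp

lemma integral_abs_rpow_succ_le (hX : Martingale X ℱ P) (hp : 2 ≤ p) {θ : ℝ} (hθ : 1 ≤ θ) (k : ℕ)
    (hk : Integrable (fun ω => |X k ω| ^ p) P)
    (hd : Integrable (fun ω => |X (k + 1) ω - X k ω| ^ p) P)
    (hk' : Integrable (fun ω => |X (k + 1) ω| ^ p) P) :
    ∫ ω, |X (k + 1) ω| ^ p ∂P ≤ ∫ ω, |X k ω| ^ p ∂P + p * (p - 1) * 2 ^ (p - 2) *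
      (θ ^ (p - 2) * ∫ ω, |X (k + 1) ω - X k ω| ^ p ∂P + (θ ^ 2)⁻¹ * ∫ ω, |X k ω| ^ p ∂P) := by
  have hm := hX.stronglyMeasurable k
  have hcross : Integrable (fun ω => |X k ω| ^ (p - 2) * X k ω * (X (k + 1) ω - X k ω)) P :=
    integrable_abs_rpow_mul_self_mul hp (hX.integrable k).1
      ((hX.integrable (k + 1)).sub (hX.integrable k)).1 hk hd
  have hzero := integral_mul_increment_eq_zero hX k
    (f := fun ω => |X k ω| ^ (p - 2) * X k ω)
    (((continuous_abs.rpow_const fun _ => Or.inr (by linarith)).mul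
      continuous_id).comp_stronglyMeasurable hm) hcross
  have hpt : ∀ ω, |X (k + 1) ω| ^ p ≤ |X k ω| ^ p
      + p * (|X k ω| ^ (p - 2) * X k ω * (X (k + 1) ω - X k ω))
      + p * (p - 1) * 2 ^ (p - 2) *
        (θ ^ (p - 2) * |X (k + 1) ω - X k ω| ^ p + (θ ^ 2)⁻¹ * |X k ω| ^ p) := fun ω => by
    have h₁ := abs_add_rpow_le_taylor hp (X k ω) (X (k + 1) ω - X k ω)
    rw [add_sub_cancel] at h₁
    have h₂ := mul_le_mul_of_nonneg_left
      (abs_add_abs_rpow_mul_sq_le hp hθ (X k ω) (X (k + 1) ω - X k ω))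
      (mul_nonneg (by linarith) (by linarith) : 0 ≤ p * (p - 1))
    linarith
  have hi₁ := hcross.const_mul p
  have hi₁₂ : Integrable (fun ω => |X k ω| ^ p
      + p * (|X k ω| ^ (p - 2) * X k ω * (X (k + 1) ω - X k ω))) P := hk.add hi₁
  have hi₂ : Integrable (fun ω => p * (p - 1) * 2 ^ (p - 2) *
      (θ ^ (p - 2) * |X (k + 1) ω - X k ω| ^ p + (θ ^ 2)⁻¹ * |X k ω| ^ p)) P := ((hd.const_mul (θ ^ (p - 2))).add (hk.const_mul (θ ^ 2)⁻¹)).const_mul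
    (p * (p - 1) * 2 ^ (p - 2))
  refine (integral_mono hk' (hi₁₂.add hi₂) hpt).trans (le_of_eq ?_)
  rw [integral_add' hi₁₂ hi₂, integral_add hk hi₁, integral_const_mul, hzero,
    integral_const_mul, integral_add (hd.const_mul _) (hk.const_mul _), integral_const_mul,
    integral_const_mul]
  ring

/-- The constant in the moment bound `integral_abs_rpow_le`. -/
noncomputable def momentConst (p : ℝ) : ℝ := (3 * (p * (p - 1) * 2 ^ (p - 2))) ^ (p / 2)

lemma momentConst_nonneg (hp : 2 ≤ p) : 0 ≤ momentConst p := by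
  have : 0 ≤ p - 1 := by linarith
  unfold momentConst
  positivity

/-- After writing both as powers `p / 2`, use `p ≤ 2(p-1)` and `t = 2^(p-1) ≥ 1`: the bases compare
as `6(p-1)² t < 64(p-1)² t²`. -/
lemma momentConst_lt_const (hp : 2 ≤ p) : momentConst p < const p := by
  have h₁ : 0 < p - 1 := by linarith
  have h₂ : (1 : ℝ) ≤ 2 ^ (p - 1) := Real.one_le_rpow (by norm_num) h₁.le
  have h₃ : (2 : ℝ) ^ (p - 2) ≤ 2 ^ (p - 1) :=
    Real.rpow_le_rpow_of_exponent_le (by norm_num) (by linarith)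
  unfold momentConst const
  rw [max_eq_right h₂]
  set t : ℝ := 2 ^ (p - 1)
  have e : (8 * (p - 1) * t) ^ p = ((8 * (p - 1) * t) ^ 2) ^ (p / 2) := by
    rw [← Real.rpow_natCast, ← Real.rpow_mul (by positivity)]
    congr 1
    push_cast; ring
  rw [e]
  refine Real.rpow_lt_rpow (by positivity) ?_ (by linarith)
  have h₄ : 3 * (p * (p - 1) * 2 ^ (p - 2)) ≤ 6 * (p - 1) ^ 2 * t := by
    have : p * (p - 1) * 2 ^ (p - 2) ≤ (2 * (p - 1)) * (p - 1) * t := by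
      gcongr
      linarith
    linarith
  have h₅ : t ≤ t ^ 2 := by nlinarith
  have h₆ := mul_le_mul_of_nonneg_left h₅ (sq_nonneg (p - 1))
  have h₇ : 0 < (p - 1) ^ 2 * t := by positivity
  nlinarith

/-- Moment bound for martingales: `E|X_n|^p ≤ C n^{p/2-1} ∑_{j<n} E|X_{j+1} - X_j|^p`. -/
theorem integral_abs_rpow_le (hX : Martingale X ℱ P) (hX0 : ∀ᵐ ω ∂P, X 0 ω = 0) (hp : 2 ≤ p)
    {n : ℕ} (hn : 1 ≤ n)
    (hd : ∀ j < n, MemLp (fun ω => X (j + 1) ω - X j ω) (ENNReal.ofReal p) P) :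
    ∫ ω, |X n ω| ^ p ∂P ≤ momentConst p * (n : ℝ) ^ (p / 2 - 1) *
      ∑ j ∈ Finset.range n, ∫ ω, |X (j + 1) ω - X j ω| ^ p ∂P := by
  have hp₀ : 0 < p := by linarith
  have hp₁ : 1 ≤ p - 1 := by linarith
  have hn₁ : (1 : ℝ) ≤ n := by exact_mod_cast hn
  have hn₀ : (0 : ℝ) < n := by linarith
  set c : ℝ := p * (p - 1) * 2 ^ (p - 2) with hc
  have hc₁ : 1 ≤ c := by
    have : (1 : ℝ) ≤ 2 ^ (p - 2) := Real.one_le_rpow (by norm_num) (by linarith)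
    have h' : 1 ≤ p * (p - 1) := by nlinarith
    nlinarith
  have hc₀ : 0 < c := by linarith
  -- This choice makes the coefficient `c / θ²` of `|X_k|^p` equal to `1 / n`.
  set θ : ℝ := √(c * n) with hθ
  have hcn : 1 ≤ c * n := by nlinarith
  have hθ₁ : 1 ≤ θ := Real.one_le_sqrt.2 hcn
  have hθ₂ : θ ^ 2 = c * n := Real.sq_sqrt (by linarith)
  set d : ℕ → ℝ := fun j => ∫ ω, |X (j + 1) ω - X j ω| ^ p ∂P with hd'
  have hd₀ : ∀ j, 0 ≤ d j := fun j => integral_nonneg fun ω => Real.rpow_nonneg (abs_nonneg _) _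
  have hint : ∀ k ≤ n, Integrable (fun ω => |X k ω| ^ p) P := fun k hk =>
    integrable_abs_rpow_of_memLp hp₀
      (memLp_of_memLp_increments hX0 k fun j hj => hd j (hj.trans_le hk))
  -- Discrete Grönwall argument; `n` and hence `θ` stay fixed while `k` runs.
  have key : ∀ k ≤ n, ∫ ω, |X k ω| ^ p ∂P
      ≤ (1 + (n : ℝ)⁻¹) ^ k * (c * θ ^ (p - 2) * ∑ j ∈ Finset.range k, d j) := by
    intro k
    induction k with
    | zero =>
      intro _
      have : ∫ ω, |X 0 ω| ^ p ∂P = ∫ ω, (0 : ℝ) ∂P := by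
        refine integral_congr_ae ?_
        filter_upwards [hX0] with ω h
        rw [h, abs_zero, Real.zero_rpow hp₀.ne']
      simp [this]
    | succ k ih =>
      intro hk
      have h₁ := integral_abs_rpow_succ_le hX hp hθ₁ k (hint k (by omega))
        (integrable_abs_rpow_of_memLp hp₀ (hd k (by omega))) (hint (k + 1) hk)
      have h₂ := ih (by omega)
      have h₃ : c * (θ ^ 2)⁻¹ = (n : ℝ)⁻¹ := by rw [hθ₂]; field_simp
      have hone : (1 : ℝ) ≤ (1 + (n : ℝ)⁻¹) ^ (k + 1) :=
        one_le_pow₀ (by have := inv_pos.2 hn₀; linarith)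
      have hcd : 0 ≤ c * θ ^ (p - 2) * d k :=
        mul_nonneg (mul_nonneg hc₀.le (Real.rpow_nonneg (by linarith) _)) (hd₀ k)
      calc ∫ ω, |X (k + 1) ω| ^ p ∂P
          ≤ (1 + c * (θ ^ 2)⁻¹) * ∫ ω, |X k ω| ^ p ∂P + c * θ ^ (p - 2) * d k := by
            refine h₁.trans (le_of_eq ?_)
            simp only [hd', ← hc]
            ring
        _ ≤ (1 + (n : ℝ)⁻¹) * ((1 + (n : ℝ)⁻¹) ^ k *
              (c * θ ^ (p - 2) * ∑ j ∈ Finset.range k, d j)) +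
              (1 + (n : ℝ)⁻¹) ^ (k + 1) * (c * θ ^ (p - 2) * d k) := by
            rw [h₃]
            exact add_le_add (mul_le_mul_of_nonneg_left h₂ (by positivity))
              (le_mul_of_one_le_left hcd hone)
        _ = _ := by
            rw [Finset.sum_range_succ]
            ring
  have hexp : (1 + (n : ℝ)⁻¹) ^ n ≤ 3 := by
    have h₁ : 1 + (n : ℝ)⁻¹ ≤ Real.exp (n : ℝ)⁻¹ := by
      have := Real.add_one_le_exp (n : ℝ)⁻¹; linarith
    calc (1 + (n : ℝ)⁻¹) ^ n ≤ Real.exp (n : ℝ)⁻¹ ^ n := by gcongr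
      _ = Real.exp 1 := by rw [← Real.exp_nat_mul, mul_inv_cancel₀ hn₀.ne']
      _ ≤ 3 := by have := Real.exp_one_lt_d9; linarith
  have hθp : c * θ ^ (p - 2) = c ^ (p / 2) * (n : ℝ) ^ (p / 2 - 1) := by
    rw [hθ, Real.sqrt_eq_rpow, ← Real.rpow_mul (by linarith),
      show 1 / 2 * (p - 2) = p / 2 - 1 by ring, Real.mul_rpow hc₀.le hn₀.le, ← mul_assoc]
    congr 1
    rw [mul_comm, ← Real.rpow_add_one hc₀.ne', sub_add_cancel]
  -- Lets the factor `3` enter the base of `momentConst`.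
  have hthree : (3 : ℝ) ≤ 3 ^ (p / 2) := by
    conv_lhs => rw [← Real.rpow_one 3]
    exact Real.rpow_le_rpow_of_exponent_le (by norm_num) (by linarith)
  have hS : 0 ≤ ∑ j ∈ Finset.range n, d j := Finset.sum_nonneg fun j _ => hd₀ j
  calc ∫ ω, |X n ω| ^ p ∂P
      ≤ (1 + (n : ℝ)⁻¹) ^ n * (c * θ ^ (p - 2) * ∑ j ∈ Finset.range n, d j) := key n le_rfl
    _ ≤ 3 ^ (p / 2) * (c * θ ^ (p - 2) * ∑ j ∈ Finset.range n, d j) := by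
        gcongr
        exact hexp.trans hthree
    _ = _ := by
        rw [hθp, momentConst, ← hc, Real.mul_rpow (by norm_num) hc₀.le]
        ring

end Moment

/-! ### Series over `n ≥ 1` and exceedance events -/

lemma tsum_Ici_one (g : ℕ → ℝ≥0∞) : ∑' n : Set.Ici 1, g n = ∑' k : ℕ, g (1 + k) := by
  let e : ℕ ≃ Set.Ici 1 :=
    { toFun := fun k => ⟨1 + k, Nat.le_add_right 1 k⟩
      invFun := fun n => n - 1
      left_inv := fun k => by simp
      right_inv := fun n => Subtype.ext (Nat.add_sub_cancel' n.2) }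
  exact (e.tsum_eq fun n : Set.Ici 1 => g n).symm

lemma tsum_Ici_one_ne_top_of_weighted {a : ℕ → ℝ} {f : ℕ → ℝ≥0∞} (ha : 0 < a 1)
    (h : ∑' n : Set.Ici 1, ENNReal.ofReal (a n) * ∑' m : Set.Ici (n : ℕ), f m < ∞) :
    ∑' m : Set.Ici 1, f m ≠ ∞ := by
  have h₁ := ENNReal.ne_top_of_tsum_ne_top h.ne ⟨1, Set.self_mem_Ici⟩
  intro htop
  refine h₁ ?_
  change ENNReal.ofReal (a 1) * ∑' m : Set.Ici 1, f m = ∞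
  rw [htop, ENNReal.mul_top (by simpa using ha)]

section Exceedance

variable {Ω : Type*} {m0 : MeasurableSpace Ω} {P : Measure Ω} {X : ℕ → Ω → ℝ} {a ε : ℕ → ℝ}

/-- The event that `|X_m / m|` exceeds `ε_m` for some `m ≥ n`. -/
def exceedAfter (X : ℕ → Ω → ℝ) (ε : ℕ → ℝ) (n : ℕ) : Set Ω :=
  ⋃ m : Set.Ici n, {ω | ε m < |X m ω / (m : ℕ)|}

lemma measurableSet_exceedAfter (hX : ∀ n, Measurable (X n)) (n : ℕ) :
    MeasurableSet (exceedAfter X ε n) :=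
  MeasurableSet.iUnion fun m =>
    measurableSet_lt measurable_const ((hX m).div_const _).abs

/-- Otherwise all exceedances lie in `{1, …, k}`, so there are at most `k` of them. -/
lemma mem_exceedAfter_of_lt_overlap {k : ℕ} {ω : Ω} (h : (k : ℕ∞) < overlap X ε ω) :
    ω ∈ exceedAfter X ε (1 + k) := by
  by_contra hω
  refine absurd h (not_lt.2 ?_)
  have hsub : {n : ℕ | 1 ≤ n ∧ ε n < |X n ω / n|} ⊆ (Finset.Icc 1 k : Set ℕ) := by
    rintro n ⟨hn, hb⟩
    rw [Finset.coe_Icc]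
    refine ⟨hn, ?_⟩
    by_contra hk
    exact hω (Set.mem_iUnion.2 ⟨⟨n, show 1 + k ≤ n by omega⟩, hb⟩)
  refine (Set.encard_le_encard hsub).trans ?_
  rw [Set.encard_coe_eq_coe_finsetCard]
  simp

/-- A measurable majorant of `partialSum a 1 (overlap X ε ω)`. -/
noncomputable def exceedSum (X : ℕ → Ω → ℝ) (a ε : ℕ → ℝ) (ω : Ω) : ℝ≥0∞ :=
  ∑' k : ℕ, (exceedAfter X ε (1 + k)).indicator (fun _ => ENNReal.ofReal (a (1 + k))) ω

lemma measurable_exceedSum (hX : ∀ n, Measurable (X n)) : Measurable (exceedSum X a ε) :=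
  Measurable.tsum fun _ =>
    measurable_const.indicator (measurableSet_exceedAfter hX _)

lemma partialSum_overlap_le (ω : Ω) : partialSum a 1 (overlap X ε ω) ≤ exceedSum X a ε ω := by
  refine ENNReal.tsum_le_tsum fun k => ?_
  split_ifs with h
  · rw [Set.indicator_of_mem (mem_exceedAfter_of_lt_overlap h)]
  · exact zero_le

lemma lintegral_exceedSum_le (hX : ∀ n, Measurable (X n)) {f : ℕ → ℝ≥0∞} {C : ℝ≥0∞}
    (hf : ∀ m ≥ 1, P {ω | ε m < |X m ω / m|} ≤ C * f m) :
    ∫⁻ ω, exceedSum X a ε ω ∂P ≤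
      C * ∑' n : Set.Ici 1, ENNReal.ofReal (a n) * ∑' m : Set.Ici (n : ℕ), f m := by
  rw [tsum_Ici_one fun n => ENNReal.ofReal (a n) * ∑' m : Set.Ici n, f m, ← ENNReal.tsum_mul_left]
  unfold exceedSum
  rw [lintegral_tsum fun k =>
    (measurable_const.indicator (measurableSet_exceedAfter hX _)).aemeasurable]
  refine ENNReal.tsum_le_tsum fun k => ?_
  rw [lintegral_indicator_const (measurableSet_exceedAfter hX _), mul_left_comm,
    ← ENNReal.tsum_mul_left]
  gcongr
  exact (measure_iUnion_le _).trans
    (ENNReal.tsum_le_tsum fun m => hf m ((Nat.le_add_right 1 k).trans m.2))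

lemma partialSum_mono {N M : ℕ∞} (h : N ≤ M) : partialSum a 1 N ≤ partialSum a 1 M := by
  refine ENNReal.tsum_le_tsum fun k => ?_
  split_ifs with h₁ h₂ h₂
  · exact le_rfl
  · exact absurd (h₁.trans_le h) h₂
  · exact zero_le
  · exact le_rfl

lemma partialSum_natCast_ne_zero (ha : ∀ n ≥ 1, 0 < a n) {k : ℕ} (hk : 1 ≤ k) :
    partialSum a 1 k ≠ 0 := by
  intro h
  have h₀ := ENNReal.tsum_eq_zero.1 h 0
  rw [if_pos (by exact_mod_cast hk), ENNReal.ofReal_eq_zero] at h₀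
  exact absurd (ha 1 le_rfl) (not_lt.2 h₀)

lemma partialSum_natCast_ne_top (k : ℕ) : partialSum a 1 k ≠ ∞ := by
  unfold partialSum
  rw [tsum_eq_sum (s := Finset.range k) fun b hb => if_neg (by simpa using hb)]
  refine ENNReal.sum_ne_top.2 fun i _ => ?_
  split_ifs <;> simp

/-- Markov's inequality for the measurable majorant `exceedSum`, which is at least `partialSum a 1
k` on the event. -/
lemma measure_le_overlap_le (hX : ∀ n, Measurable (X n)) (ha : ∀ n ≥ 1, 0 < a n) {k : ℕ}
    (hk : 1 ≤ k) :
    P {ω | (k : ℕ∞) ≤ overlap X ε ω} ≤ (partialSum a 1 k)⁻¹ * ∫⁻ ω, exceedSum X a ε ω ∂P := by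
  rw [mul_comm, ← div_eq_mul_inv]
  refine (measure_mono fun ω hω => ?_).trans
    (meas_ge_le_lintegral_div (measurable_exceedSum hX).aemeasurable
      (partialSum_natCast_ne_zero ha hk) (partialSum_natCast_ne_top k))
  exact (partialSum_mono hω).trans (partialSum_overlap_le ω)

/-- Borel–Cantelli for the exceedance events. -/
lemma ae_eventually_abs_div_le {f : ℕ → ℝ≥0∞} {C : ℝ≥0∞} (hC : C ≠ ∞)
    (hf : ∀ m ≥ 1, P {ω | ε m < |X m ω / m|} ≤ C * f m) (hsum : ∑' m : Set.Ici 1, f m ≠ ∞) :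
    ∀ᵐ ω ∂P, ∀ᶠ n : ℕ in atTop, |X n ω / n| ≤ ε n := by
  rw [tsum_Ici_one] at hsum
  have h : ∑' k : ℕ, P {ω | ε (1 + k) < |X (1 + k) ω / (1 + k : ℕ)|} ≠ ∞ := by
    refine ne_top_of_le_ne_top (ENNReal.mul_ne_top hC hsum) ?_
    rw [← ENNReal.tsum_mul_left]
    exact ENNReal.tsum_le_tsum fun k => hf _ (Nat.le_add_right 1 k)
  filter_upwards [ae_eventually_notMem h] with ω hω
  obtain ⟨N, hN⟩ := eventually_atTop.1 hω
  filter_upwards [eventually_ge_atTop (1 + N)] with n hn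
  have := hN (n - 1) (by omega)
  rw [Nat.add_sub_cancel' (by omega : 1 ≤ n)] at this
  exact not_lt.1 this

end Exceedance

/-! ### Exceedance probabilities of the martingale -/

section Martingale

variable {Ω : Type*} {m0 : MeasurableSpace Ω} {P : Measure Ω} {X : ℕ → Ω → ℝ} {p : ℝ}

/-- An infinite moment would make the term `n = j + 1` of the series infinite. This supplies the
integrability needed for the moment bound. -/
lemma lintegral_increment_lt_top_of_sumBeta_lt_top (hK : sumBeta P X p < ∞) (j : ℕ) :
    ∫⁻ ω, ENNReal.ofReal (|X (j + 1) ω - X j ω| ^ p) ∂P < ∞ := by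
  have h := ENNReal.ne_top_of_tsum_ne_top hK.ne ⟨j + 1, Nat.le_add_left 1 j⟩
  refine lt_top_iff_ne_top.2 fun htop => h ?_
  have hb : beta P X p (j + 1) = ∞ := by
    unfold beta
    rw [ENNReal.sum_eq_top.2 ⟨j, Finset.self_mem_range_succ j, htop⟩]
    exact ENNReal.top_div_of_ne_top (ENNReal.natCast_ne_top _)
  rw [hb]
  exact ENNReal.top_div_of_ne_top
    (ENNReal.rpow_ne_top_of_ne_zero (by simp) (ENNReal.natCast_ne_top _))

lemma beta_div_const_mul {e : ℝ} (he : 0 < e) (hp : 0 < p) {n : ℕ} :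
    beta P X p n / (ENNReal.ofReal e ^ p * (n : ℝ≥0∞) ^ (p / 2 - 1))
      = ENNReal.ofReal (e ^ (-p)) * (beta P X p n / (n : ℝ≥0∞) ^ (p / 2 - 1)) := by
  have hE₀ : ENNReal.ofReal e ^ p ≠ 0 :=
    (ENNReal.rpow_pos (by simpa using he) ENNReal.ofReal_ne_top).ne'
  have hEt : ENNReal.ofReal e ^ p ≠ ∞ := ENNReal.rpow_ne_top_of_nonneg hp.le ENNReal.ofReal_ne_top
  rw [div_eq_mul_inv, div_eq_mul_inv (beta P X p n), ENNReal.mul_inv (Or.inl hE₀) (Or.inl hEt),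
    ← ENNReal.rpow_neg, ENNReal.ofReal_rpow_of_pos he]
  ring

variable [IsProbabilityMeasure P] {ℱ : Filtration ℕ m0}

lemma lintegral_abs_rpow_le (hX : Martingale X ℱ P) (hX0 : ∀ᵐ ω ∂P, X 0 ω = 0) (hp : 2 ≤ p)
    (hK : sumBeta P X p < ∞) {n : ℕ} (hn : 1 ≤ n) :
    ∫⁻ ω, ENNReal.ofReal (|X n ω| ^ p) ∂P
      ≤ ENNReal.ofReal (momentConst p) * (n : ℝ≥0∞) ^ (p / 2) * beta P X p n := by
  have hp₀ : 0 < p := by linarith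
  have hd : ∀ j, MemLp (fun ω => X (j + 1) ω - X j ω) (ENNReal.ofReal p) P := fun j =>
    memLp_of_lintegral_abs_rpow_lt_top hp₀ ((hX.integrable (j + 1)).sub (hX.integrable j)).1
      (lintegral_increment_lt_top_of_sumBeta_lt_top hK j)
  have hn₀ : (n : ℝ≥0∞) ≠ 0 := by exact_mod_cast (by omega : n ≠ 0)
  have hnn : ∀ f : Ω → ℝ, 0 ≤ᵐ[P] fun ω => |f ω| ^ p := fun f =>
    ae_of_all _ fun ω => Real.rpow_nonneg (abs_nonneg _) _
  have hbeta : (n : ℝ≥0∞) * beta P X p n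
      = ENNReal.ofReal (∑ j ∈ Finset.range n, ∫ ω, |X (j + 1) ω - X j ω| ^ p ∂P) := by
    unfold beta
    rw [ENNReal.mul_div_cancel hn₀ (ENNReal.natCast_ne_top n),
      ENNReal.ofReal_sum_of_nonneg fun j _ => integral_nonneg_of_ae (hnn _)]
    exact Finset.sum_congr rfl fun j _ =>
      (ofReal_integral_eq_lintegral_ofReal (integrable_abs_rpow_of_memLp hp₀ (hd j)) (hnn _)).symm
  have hpow : (n : ℝ≥0∞) ^ (p / 2) = ENNReal.ofReal ((n : ℝ) ^ (p / 2 - 1)) * n := by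
    rw [← ENNReal.ofReal_rpow_of_pos (by exact_mod_cast hn), ENNReal.ofReal_natCast]
    conv_rhs => rw [← ENNReal.rpow_one (n : ℝ≥0∞), ← ENNReal.rpow_mul, one_mul,
      ← ENNReal.rpow_add _ _ hn₀ (ENNReal.natCast_ne_top n), sub_add_cancel]
  rw [← ofReal_integral_eq_lintegral_ofReal (integrable_abs_rpow_of_memLp hp₀
    (memLp_of_memLp_increments hX0 n fun j _ => hd j)) (hnn _), hpow, mul_assoc, mul_assoc, hbeta,
    ← ENNReal.ofReal_mul (by positivity), ← ENNReal.ofReal_mul (momentConst_nonneg hp),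
    ← mul_assoc]
  exact ENNReal.ofReal_le_ofReal (integral_abs_rpow_le hX hX0 hp hn fun j _ => hd j)

lemma measure_exceed_le (hX : Martingale X ℱ P) (hX0 : ∀ᵐ ω ∂P, X 0 ω = 0) (hp : 2 ≤ p)
    (hK : sumBeta P X p < ∞) {e : ℝ} (he : 0 < e) {n : ℕ} (hn : 1 ≤ n) :
    P {ω | e < |X n ω / n|} ≤ ENNReal.ofReal (momentConst p) *
      (beta P X p n / (ENNReal.ofReal e ^ p * (n : ℝ≥0∞) ^ (p / 2 - 1))) := by
  have hp₀ : 0 < p := by linarith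
  have hn₀ : (n : ℝ≥0∞) ≠ 0 := by exact_mod_cast (by omega : n ≠ 0)
  have hn₁ : (1 : ℝ≥0∞) ≤ n := by exact_mod_cast hn
  have hn' : (0 : ℝ) < n := by exact_mod_cast hn
  have hnt := ENNReal.natCast_ne_top n
  have he₀ : ENNReal.ofReal e ≠ 0 := by simpa using he
  have hE₀ : ENNReal.ofReal e ^ p ≠ 0 := (ENNReal.rpow_pos (pos_iff_ne_zero.2 he₀) ENNReal.ofReal_ne_top).ne'
  have hEt : ENNReal.ofReal e ^ p ≠ ∞ := ENNReal.rpow_ne_top_of_nonneg hp₀.le ENNReal.ofReal_ne_top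
  have hN₀ : ∀ r : ℝ, (n : ℝ≥0∞) ^ r ≠ 0 := fun r => (ENNReal.rpow_pos (by positivity) hnt).ne'
  have hNt : ∀ r : ℝ, (n : ℝ≥0∞) ^ r ≠ ∞ := fun r => ENNReal.rpow_ne_top_of_ne_zero hn₀ hnt
  have hmeas : AEMeasurable (fun ω => ENNReal.ofReal (|X n ω| ^ p)) P :=
    (((hX.integrable n).1.aemeasurable.abs).pow_const p).ennreal_ofReal
  -- Markov's inequality for `|X_n|^p` at level `(e n)^p`.
  have hmarkov := meas_ge_le_lintegral_div hmeas
    (mul_ne_zero hE₀ (hN₀ p)) (ENNReal.mul_ne_top hEt (hNt p))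
  refine (measure_mono fun ω hω => ?_).trans (hmarkov.trans ?_)
  · have hω' : e < |X n ω / n| := hω
    rw [abs_div, abs_of_pos hn', lt_div_iff₀ hn'] at hω'
    have := Real.rpow_le_rpow (by positivity) hω'.le hp₀.le
    change _ ≤ ENNReal.ofReal _
    rw [← ENNReal.mul_rpow_of_nonneg _ _ hp₀.le, ← ENNReal.ofReal_natCast n,
      ← ENNReal.ofReal_mul he.le, ENNReal.ofReal_rpow_of_nonneg (by positivity) hp₀.le]
    exact ENNReal.ofReal_le_ofReal this
  · refine ENNReal.div_le_of_le_mul ((lintegral_abs_rpow_le hX hX0 hp hK hn).trans ?_)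
    have hsplit : (n : ℝ≥0∞) ^ p = (n : ℝ≥0∞) ^ (p / 2 - 1) * (n : ℝ≥0∞) ^ (p / 2 + 1) := by
      rw [← ENNReal.rpow_add _ _ hn₀ hnt]
      congr 1; ring
    calc ENNReal.ofReal (momentConst p) * (n : ℝ≥0∞) ^ (p / 2) * beta P X p n
        -- A factor `n` is given away: the moment bound would allow `n^(p/2)` in the denominator,
        -- while the series uses `n^(p/2-1)`.
        ≤ ENNReal.ofReal (momentConst p) * (n : ℝ≥0∞) ^ (p / 2 + 1) * beta P X p n := by
          gcongr
          linarith
      _ = ENNReal.ofReal (momentConst p) *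
          (beta P X p n / (ENNReal.ofReal e ^ p * (n : ℝ≥0∞) ^ (p / 2 - 1)) *
            (ENNReal.ofReal e ^ p * (n : ℝ≥0∞) ^ (p / 2 - 1))) * (n : ℝ≥0∞) ^ (p / 2 + 1) := by
          rw [ENNReal.div_mul_cancel (mul_ne_zero hE₀ (hN₀ _)) (ENNReal.mul_ne_top hEt (hNt _))]
          ring
      _ = _ := by
          rw [hsplit]
          ring

lemma ae_tendsto_div_atTop (hX : Martingale X ℱ P) (hX0 : ∀ᵐ ω ∂P, X 0 ω = 0) (hp : 2 ≤ p)
    (hK : sumBeta P X p < ∞) : ∀ᵐ ω ∂P, Tendsto (fun n : ℕ => X n ω / n) atTop (𝓝 0) := by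
  have h : ∀ k : ℕ, ∀ᵐ ω ∂P, ∀ᶠ n : ℕ in atTop, |X n ω / n| ≤ 1 / ((k : ℝ) + 1) := fun k => by
    have hk : 0 < 1 / ((k : ℝ) + 1) := Nat.one_div_pos_of_nat
    refine ae_eventually_abs_div_le (ε := fun _ => 1 / ((k : ℝ) + 1))
      (C := ENNReal.ofReal (momentConst p) * ENNReal.ofReal ((1 / ((k : ℝ) + 1)) ^ (-p)))
      (f := fun m => beta P X p m / (m : ℝ≥0∞) ^ (p / 2 - 1))
      (ENNReal.mul_ne_top ENNReal.ofReal_ne_top ENNReal.ofReal_ne_top) (fun m hm => ?_) hK.ne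
    rw [mul_assoc, ← beta_div_const_mul hk (by linarith)]
    exact measure_exceed_le hX hX0 hp hK hk hm
  filter_upwards [ae_all_iff.2 h] with ω hω
  rw [Metric.tendsto_nhds]
  intro δ hδ
  obtain ⟨k, hk⟩ := exists_nat_one_div_lt hδ
  filter_upwards [hω k] with n hn
  rw [Real.dist_eq, sub_zero]
  exact hn.trans_lt hk

/-- The bound behind part (a), with a constant smaller than `const p`. -/
lemma lintegral_exceedSum_const_le (hX : Martingale X ℱ P) (hX0 : ∀ᵐ ω ∂P, X 0 ω = 0)
    (hp : 2 ≤ p) (hK : sumBeta P X p < ∞) {e : ℝ} (he : 0 < e) (a : ℕ → ℝ) :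
    ∫⁻ ω, exceedSum X a (fun _ => e) ω ∂P
      ≤ ENNReal.ofReal (momentConst p * e ^ (-p)) * weightedSum P X a p := by
  refine lintegral_exceedSum_le (f := fun m => beta P X p m / (m : ℝ≥0∞) ^ (p / 2 - 1))
    (fun n => ((hX.stronglyMeasurable n).mono (ℱ.le n)).measurable) fun m hm => ?_
  rw [ENNReal.ofReal_mul (momentConst_nonneg hp), mul_assoc, ← beta_div_const_mul he (by linarith)]
  exact measure_exceed_le hX hX0 hp hK he hm

end Martingale

end MDF

/-! ### The main theorem -/

theorem mainTheorem6 {Ω : Type*} [MeasurableSpace Ω] (P : Measure Ω) [IsProbabilityMeasure P]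
    (ℱ : Filtration ℕ ‹MeasurableSpace Ω›) (X : ℕ → Ω → ℝ) (hX : Martingale X ℱ P)
    (hX0 : ∀ᵐ ω ∂P, X 0 ω = 0) (p : ℝ) (hp : 2 ≤ p) (hK : MDF.sumBeta P X p < ∞) :
    (∀ᵐ ω ∂P, Tendsto (fun n : ℕ => X n ω / n) atTop (𝓝 0)) ∧
    (∀ (ε : ℝ) (a : ℕ → ℝ), 0 < ε → (∀ n ≥ 1, 0 < a n) → MonotoneOn a (Set.Ici 1) →
      MDF.weightedSum P X a p < ∞ →
        (∫⁻ ω, MDF.partialSum a 1 (MDF.overlap X (fun _ => ε) ω) ∂P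
            ≤ ENNReal.ofReal (MDF.const p * ε ^ (-p)) * MDF.weightedSum P X a p) ∧
        (0 < MDF.weightedSum P X a p →
          ∫⁻ ω, MDF.partialSum a 1 (MDF.overlap X (fun _ => ε) ω) ∂P
            < ENNReal.ofReal (MDF.const p * ε ^ (-p)) * MDF.weightedSum P X a p) ∧
        (∀ k : ℕ, 1 ≤ k →
          P {ω | (k : ℕ∞) ≤ MDF.overlap X (fun _ => ε) ω}
            ≤ (MDF.partialSum a 1 k)⁻¹ *
              (ENNReal.ofReal (MDF.const p * ε ^ (-p)) * MDF.weightedSum P X a p))) ∧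
    (∀ ε a : ℕ → ℝ, (∀ n ≥ 1, 0 < ε n) → AntitoneOn ε (Set.Ici 1) →
      (∀ n ≥ 1, 0 < a n) → MonotoneOn a (Set.Ici 1) →
      MDF.weightedSumTol P X a ε p < ∞ →
        (∀ᵐ ω ∂P, limsup (fun n : ℕ => ((|X n ω / n| * (ε n)⁻¹ : ℝ) : EReal)) atTop ≤ 1) ∧
        (∫⁻ ω, MDF.partialSum a 1 (MDF.overlap X ε ω) ∂P
            ≤ ENNReal.ofReal (MDF.const p) * MDF.weightedSumTol P X a ε p)) := by
  have hmeas : ∀ n, Measurable (X n) := fun n =>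
    ((hX.stronglyMeasurable n).mono (ℱ.le n)).measurable
  have hC := MDF.momentConst_lt_const hp
  have hC₀ := MDF.momentConst_nonneg hp
  refine ⟨MDF.ae_tendsto_div_atTop hX hX0 hp hK, fun ε a hε ha _ hW => ?_,
    fun ε a hε _ ha _ hW => ?_⟩
  · have hε' : 0 < ε ^ (-p) := Real.rpow_pos_of_pos hε _
    have hlt : ENNReal.ofReal (MDF.momentConst p * ε ^ (-p))
        < ENNReal.ofReal (MDF.const p * ε ^ (-p)) :=
      (ENNReal.ofReal_lt_ofReal_iff (mul_pos (hC₀.trans_lt hC) hε')).2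
        (mul_lt_mul_of_pos_right hC hε')
    have hle := MDF.lintegral_exceedSum_const_le hX hX0 hp hK hε a
    have hint := (lintegral_mono (μ := P)
      (MDF.partialSum_overlap_le (X := X) (a := a) (ε := fun _ => ε))).trans hle
    refine ⟨hint.trans (by gcongr), fun hpos => hint.trans_lt ?_, fun k hk => ?_⟩
    -- The strict gap between the constants survives multiplication because `K_{a,p}` is neither `0`
    -- nor `∞`.
    · exact ENNReal.mul_lt_mul_left hpos.ne' hW.ne hlt
    · refine (MDF.measure_le_overlap_le hmeas ha hk).trans ?_
      gcongr
      exact hle.trans (by gcongr)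
  · have hbound : ∀ m ≥ 1, P {ω | ε m < |X m ω / m|} ≤ ENNReal.ofReal (MDF.momentConst p) *
        (MDF.beta P X p m / (ENNReal.ofReal (ε m) ^ p * (m : ℝ≥0∞) ^ (p / 2 - 1))) :=
      fun m hm => MDF.measure_exceed_le hX hX0 hp hK (hε m hm) hm
    -- The term `n = 1` of the weighted series, with `a_1 > 0`, already gives the summability
    -- required by Borel–Cantelli.
    have hsum := MDF.tsum_Ici_one_ne_top_of_weighted
      (f := fun m => MDF.beta P X p m / (ENNReal.ofReal (ε m) ^ p * (m : ℝ≥0∞) ^ (p / 2 - 1)))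
      (ha 1 le_rfl) hW
    constructor
    · filter_upwards [MDF.ae_eventually_abs_div_le ENNReal.ofReal_ne_top hbound
        hsum] with ω hω
      refine limsup_le_of_le (by isBoundedDefault) ?_
      filter_upwards [hω, eventually_ge_atTop 1] with n hn hn₁
      rw [← EReal.coe_one, EReal.coe_le_coe_iff, ← div_eq_mul_inv]
      exact (div_le_one (hε n hn₁)).2 hn
    · refine ((lintegral_mono MDF.partialSum_overlap_le).trans
        (MDF.lintegral_exceedSum_le hmeas hbound)).trans ?_
      unfold MDF.weightedSumTol
      gcongr
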